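/- Let $\langle a_1,\dots,a_m \,\|\, \mathcal R\rangle$ be a group presentation with a finite alphabet $\mathcal A=\{a_1,\dots,a_m\}$ and an arbitrary (possibly infinite) set $\mathcal R$ of nonempty cyclically reduced words over $\mathcal A^{\pm1}$; let $\langle\langle\mathcal R\rangle\rangle$ be the normal closure of $\mathcal R$ in the free group $F(\mathcal A)$. A van Kampen diagram over the presentation is a finite, connected and simply connected planar 2-complex $\Delta$ whose oriented edges are labelled by letters of $\mathcal A^{\pm1}$, inverse edges having inverse labels, such that the boundary of every 2-cell reads, up to a cyclic shift, a word of $\mathcal R$ or the inverse of one. Let $|\Delta(j)|$ be the number of $j$-cells of $\Delta$. For a (not necessarily reduced) word $W$ over $\mathcal A^{\pm1}$ that represents an element of $\langle\langle\mathcal R\rangle\rangle$, let $L_j(W)$, $j\in\{0,1,2\}$, be the least $|\Delta(j)|$ over all van Kampen diagrams $\Delta$ whose boundary path is labelled by the cyclic word $W$, and for integers $x\ge 1$ let $$f_j(x)=\max\{\,L_j(W) \mid W\in\langle\langle\mathcal R\rangle\rangle,\ |W|\le x\,\}.$$ For functions $f,g:\{1,2,\dots\}\to\{0,1,2,\dots\}$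 write $f\preccurlyeq g$ if there is an integer $C>0$ with $f(x)\le C\,g(Cx)+Cx$ for all integers $x\ge 1$, and $f\simeq g$ (linear equivalence) if $f\preccurlyeq g$ and $g\preccurlyeq f$. (a) For every such presentation and every integer $x\ge1$, $f_2(x)\le 2f_1(x)$, and $f_0(x)\le 2f_1(x)$ except in the degenerate case $f_1(x)=0$, in which $f_0(x)=1$. If $m\ge 1$, then $f_0(x)\le 2f_1(x)$ for all $x\ge 2$. In particular, $f_0\preccurlyeq f_1$ and $f_2\preccurlyeq f_1$. (b) If every word in $\mathcal R$ has length $>1$, then $f_0\simeq f_1$; more precisely, $f_1(x)\le 3(1+2m)f_0(x)$ for every integer $x\ge1$. -/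

import Mathlib

/-- Words, not necessarily reduced, over the alphabet `𝒜^{±1}`, `𝒜 = {a₁, …, a_m}`:
`(a, true)` is the letter `a` and `(a, false)` is the letter `a⁻¹`. -/
abbrev DehnWord (m : ℕ) : Type := List (Fin m × Bool)

/-- Reversal of orientation on the oriented edges `(e, true)`, `(e, false)`. -/
def reverseEdge (E : Type) : Equiv.Perm (E × Bool) :=
  (Equiv.refl E).prodCongr Equiv.boolNot

/-- A finite, connected and simply connected 2-complex embedded in an oriented plane, given
combinatorially: by its sets of 0-cells, 1-cells and 2-cells, together with the rotation system of
the embedding of its 1-skeleton.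

Every 1-cell `e` is given a reference orientation; its two orientations are the oriented edges
`(e, true)` and `(e, false)`. Since the complex is connected and simply connected, the regions of
the plane cut out by its 1-skeleton are its 2-cells and exactly one more region, the exterior of
the complex; they form `Option Face`, with `none` for the exterior. Conversely, on such data the
formula of Euler says that the regions fit together to a sphere, from which the exterior, an open
disk, is removed. -/
structure PlanarDisk where
  /-- The 0-cells. -/
  Vertex : Type
  /-- The 1-cells. -/
  Edge : Type
  /-- The 2-cells. -/
  Face : Type
  finite_vertex : Finite Vertex
  finite_edge : Finite Edge
  finite_face : Finite Face
  nonempty_vertex : Nonempty Vertex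
  /-- The initial vertex of an oriented edge. -/
  source : Edge × Bool → Vertex
  /-- The region on the left-hand side of an oriented edge. -/
  left : Edge × Bool → Option Face
  /-- The oriented edge that follows `d` on the boundary of the region to the left of `d`. -/
  next : Equiv.Perm (Edge × Bool)
  /-- The oriented edges with the same left-hand region form one boundary cycle, traced
  by `next`. -/
  left_eq_iff : ∀ d d', left d = left d' ↔ next.SameCycle d d'
  /-- The oriented edges that start at the same vertex form one cycle of the rotation about that
  vertex, which takes `d` to the successor of the reverse of `d`. -/
  source_eq_iff : ∀ d d', source d = source d' ↔
    (next * reverseEdge Edge).SameCycle d d'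
  /-- Every 2-cell has an edge on its boundary. -/
  face_boundary : ∀ f : Face, ∃ d, left d = some f
  /-- The exterior has an edge on its boundary, unless the complex is a single point. -/
  exterior_boundary : Nonempty Edge → ∃ d, left d = none
  connected : ∀ u v : Vertex, Relation.ReflTransGen
    (fun p q => ∃ d, source d = p ∧ source (reverseEdge Edge d) = q) u v
  euler : Nat.card Vertex + Nat.card Face = Nat.card Edge + 1

namespace PlanarDisk

/-- The number `|Δ(j)|` of `j`-cells. -/
noncomputable def numCells (Δ : PlanarDisk) : Fin 3 → ℕ :=
  ![Nat.card Δ.Vertex, Nat.card Δ.Edge, Nat.card Δ.Face]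

/-- The number of oriented edges on the boundary of a region. -/
noncomputable def perimeter (Δ : PlanarDisk) (f : Option Δ.Face) : ℕ :=
  Nat.card {d : Δ.Edge × Bool // Δ.left d = f}

end PlanarDisk

/-- A planar disk complex whose 1-cells are mapped onto the 1-cells of the presentation complex:
`edgeLabel e` is the generator onto which `e` is mapped, the reference orientation of `e` being the
one that corresponds to the positive letter. -/
structure LabelledDisk (m : ℕ) extends PlanarDisk where
  edgeLabel : Edge → Fin m

namespace LabelledDisk

variable {m : ℕ}

/-- The label `φ(d) ∈ 𝒜^{±1}` of an oriented edge. -/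
def letter (Δ : LabelledDisk m) (d : Δ.Edge × Bool) : Fin m × Bool :=
  (Δ.edgeLabel d.1, d.2)

/-- `W` is read along the boundary cycle of the region `f`, once around, from some starting point.
Thus `W` is determined up to a cyclic shift. The boundary of the exterior of a one-point complex
reads the empty word. -/
def Reads (Δ : LabelledDisk m) (f : Option Δ.Face) (W : DehnWord m) : Prop :=
  (Δ.perimeter f = 0 ∧ W = []) ∨
    ∃ d, Δ.left d = f ∧ W = (List.iterate Δ.next d (Δ.perimeter f)).map Δ.letter

/-- `Δ` is a van Kampen diagram over `⟨a₁, …, a_m ‖ R⟩`: the boundary of every 2-cell reads a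
relator or the inverse of a relator. -/
def IsVanKampen (R : Set (DehnWord m)) (Δ : LabelledDisk m) : Prop :=
  ∀ f : Δ.Face, ∃ r ∈ R, Δ.Reads (some f) r ∨ Δ.Reads (some f) (FreeGroup.invRev r)

end LabelledDisk

/-- `W ∈ ⟨⟨R⟩⟩`: the word `W` represents an element of the normal closure of `R` in the free
group. -/
def InNormalClosure {m : ℕ} (R : Set (DehnWord m)) (W : DehnWord m) : Prop :=
  FreeGroup.mk W ∈ Subgroup.normalClosure (FreeGroup.mk '' R)

/-- `L_j(W)`, the least number of `j`-cells in a van Kampen diagram over `⟨a₁, …, a_m ‖ R⟩` with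
boundary label `W`. (Such diagrams exist if and only if `W ∈ ⟨⟨R⟩⟩`.) -/
noncomputable def dehnL {m : ℕ} (R : Set (DehnWord m)) (j : Fin 3) (W : DehnWord m) : ℕ :=
  sInf {n | ∃ Δ : LabelledDisk m, Δ.IsVanKampen R ∧ Δ.Reads none W ∧ Δ.numCells j = n}

/-- The Dehn `j`-function `f_j(x)`, the largest `L_j(W)` over the finitely many words
`W ∈ ⟨⟨R⟩⟩` of length at most `x`. -/
noncomputable def dehnFunction {m : ℕ} (R : Set (DehnWord m)) (j : Fin 3) (x : ℕ) : ℕ :=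
  sSup {n | ∃ W : DehnWord m, InNormalClosure R W ∧ W.length ≤ x ∧ dehnL R j W = n}

/-- `f ≼ g` for functions on the positive integers. -/
def LinearlyDominated (f g : ℕ → ℕ) : Prop :=
  ∃ C : ℕ, 0 < C ∧ ∀ x : ℕ, 1 ≤ x → f x ≤ C * g (C * x) + C * x

/-- `f ≃ g`, linear equivalence. -/
def LinearlyEquivalent (f g : ℕ → ℕ) : Prop :=
  LinearlyDominated f g ∧ LinearlyDominated g f

namespace PlanarDisk

/-! Part (a) is Euler's formula V + F = E + 1 applied to a diagram with fewest edges: V ≤ E + 1 ≤ 2E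
once E ≥ 1, and F ≤ E because V ≥ 1.

Part (b) needs E bounded by V, and only parallel edges bounding digons can spoil this. Take a
diagram with fewest vertices and, among those, fewest edges. Two edges of a chain of digons that
carry the same letter can be glued: the digons between them disappear, each together with one edge,
while the vertices and all other boundary labels survive (`DigonChain.collapse`, `reads_collapse`).
By minimality the letters along each chain are therefore distinct. Follow digons from an oriented
edge until its left side is no longer a digon: the final edge and the initial letter determine the
initial edge. Euler's formula leaves fewer than 6V final edges when no 2-cell has perimeter 1
(`card_not_isDigonal_le`), and there are 2m letters, so 2E ≤ 2m · 6V. -/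

theorem reverseEdge_apply {E : Type} (d : E × Bool) : reverseEdge E d = (d.1, !d.2) := rfl

@[simp]
theorem reverseEdge_reverseEdge {E : Type} (d : E × Bool) :
    reverseEdge E (reverseEdge E d) = d := by
  simp [reverseEdge_apply]

theorem reverseEdge_ne {E : Type} (d : E × Bool) : reverseEdge E d ≠ d := by
  intro h
  have := congrArg Prod.snd h
  simp [reverseEdge_apply] at this

theorem eq_or_eq_reverseEdge {E : Type} {d d' : E × Bool} (h : d.1 = d'.1) :
    d = d' ∨ d = reverseEdge E d' := by
  obtain ⟨e, b⟩ := d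
  obtain ⟨e', b'⟩ := d'
  obtain rfl : e = e' := h
  cases b <;> cases b' <;> simp [reverseEdge_apply]

/-! ### Chains of digons and their collapse -/

variable (Δ : PlanarDisk)

theorem left_next (d : Δ.Edge × Bool) : Δ.left (Δ.next d) = Δ.left d :=
  (Δ.left_eq_iff _ _).2 ((Equiv.Perm.sameCycle_apply_left).2 (Equiv.Perm.SameCycle.refl _ _))

theorem source_next (d : Δ.Edge × Bool) :
    Δ.source (Δ.next d) = Δ.source (reverseEdge Δ.Edge d) := by
  refine (Δ.source_eq_iff _ _).2 ?_
  have : Δ.next d = (Δ.next * reverseEdge Δ.Edge) (reverseEdge Δ.Edge d) := by simp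
  rw [this]
  exact (Equiv.Perm.sameCycle_apply_left).2 (Equiv.Perm.SameCycle.refl _ _)

/-- A sequence `d 0, …, d k` of parallel oriented edges of distinct 1-cells, where `d t` and the
reverse of `d (t + 1)` are the two edges of a digonal 2-cell. -/
structure DigonChain (d : ℕ → Δ.Edge × Bool) (k : ℕ) : Prop where
  left_ne : ∀ t < k, Δ.left (d t) ≠ none
  next_forward : ∀ t < k, Δ.next (d t) = reverseEdge Δ.Edge (d (t + 1))
  next_backward : ∀ t < k, Δ.next (reverseEdge Δ.Edge (d (t + 1))) = d t
  injective : ∀ i ≤ k, ∀ j ≤ k, (d i).1 = (d j).1 → i = j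

namespace DigonChain

variable {Δ} {d : ℕ → Δ.Edge × Bool} {k : ℕ}

/-- The 1-cells that survive the collapse of a chain of digons onto its first edge. -/
abbrev KeptEdge (Δ : PlanarDisk) (d : ℕ → Δ.Edge × Bool) (k : ℕ) : Type :=
  {e : Δ.Edge // ∀ t, 1 ≤ t → t ≤ k → e ≠ (d t).1}

/-- The first edge of the chain, as an oriented edge of the collapsed complex. -/
def base (h : Δ.DigonChain d k) : KeptEdge Δ d k × Bool :=
  (⟨(d 0).1, fun t h1 hk he => by
    have := h.injective 0 (Nat.zero_le _) t hk he
    omega⟩, (d 0).2)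

open Classical in
/-- The oriented edge of the original complex whose left-hand side survives on the left of the
given oriented edge of the collapsed complex. -/
noncomputable def lift (h : Δ.DigonChain d k) (x : KeptEdge Δ d k × Bool) : Δ.Edge × Bool :=
  if x = h.base then d k else (x.1.1, x.2)

open Classical in
/-- The image of an oriented edge in the collapsed complex. -/
noncomputable def proj (h : Δ.DigonChain d k) (z : Δ.Edge × Bool) : KeptEdge Δ d k × Bool :=
  if hz : ∀ t, 1 ≤ t → t ≤ k → z.1 ≠ (d t).1 then (⟨z.1, hz⟩, z.2)
  else if ∃ t ≤ k, z = d t then h.base else reverseEdge _ h.base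

theorem ne_reverseEdge (h : Δ.DigonChain d k) {i j : ℕ} (hi : i ≤ k) (hj : j ≤ k) :
    d i ≠ reverseEdge Δ.Edge (d j) := by
  intro he
  obtain rfl := h.injective i hi j hj (by rw [he]; rfl)
  exact reverseEdge_ne _ he.symm

theorem proj_chain (h : Δ.DigonChain d k) {t : ℕ} (ht : t ≤ k) : h.proj (d t) = h.base := by
  unfold proj
  split_ifs with h1 h2
  · rcases Nat.eq_zero_or_pos t with rfl | h0
    · rfl
    · exact absurd rfl (h1 t h0 ht)
  · rfl
  · exact absurd ⟨t, ht, rfl⟩ h2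

theorem proj_reverse_chain (h : Δ.DigonChain d k) {t : ℕ} (ht : t ≤ k) :
    h.proj (reverseEdge _ (d t)) = reverseEdge _ h.base := by
  unfold proj
  split_ifs with h1 h2
  · rcases Nat.eq_zero_or_pos t with rfl | h0
    · rfl
    · exact absurd rfl (h1 t h0 ht)
  · obtain ⟨s, hs, he⟩ := h2
    exact absurd he.symm (h.ne_reverseEdge hs ht)
  · rfl

theorem proj_kept (h : Δ.DigonChain d k) (x : KeptEdge Δ d k × Bool) :
    h.proj (x.1.1, x.2) = x := by
  exact dif_pos x.1.2

theorem cases_kept (z : Δ.Edge × Bool) :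
    (∃ x : KeptEdge Δ d k × Bool, z = (x.1.1, x.2)) ∨
      ∃ t, 1 ≤ t ∧ t ≤ k ∧ (z = d t ∨ z = reverseEdge _ (d t)) := by
  by_cases hz : ∀ t, 1 ≤ t → t ≤ k → z.1 ≠ (d t).1
  · exact .inl ⟨(⟨z.1, hz⟩, z.2), rfl⟩
  · push Not at hz
    obtain ⟨t, h1, hk, he⟩ := hz
    exact .inr ⟨t, h1, hk, eq_or_eq_reverseEdge he⟩

theorem proj_reverse (h : Δ.DigonChain d k) (z : Δ.Edge × Bool) :
    h.proj (reverseEdge _ z) = reverseEdge _ (h.proj z) := by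
  rcases cases_kept (d := d) (k := k) z with ⟨x, rfl⟩ | ⟨t, -, hk, rfl | rfl⟩
  · rw [h.proj_kept]
    exact h.proj_kept (reverseEdge _ x)
  · rw [h.proj_chain hk, h.proj_reverse_chain hk]
  · rw [reverseEdge_reverseEdge, h.proj_chain hk, h.proj_reverse_chain hk,
      reverseEdge_reverseEdge]

theorem lift_base (h : Δ.DigonChain d k) : h.lift h.base = d k := if_pos rfl

theorem lift_of_ne (h : Δ.DigonChain d k) {x : KeptEdge Δ d k × Bool} (hx : x ≠ h.base) :
    h.lift x = (x.1.1, x.2) := if_neg hx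

theorem proj_lift (h : Δ.DigonChain d k) (x : KeptEdge Δ d k × Bool) : h.proj (h.lift x) = x := by
  by_cases hx : x = h.base
  · rw [hx, h.lift_base, h.proj_chain le_rfl]
  · rw [h.lift_of_ne hx, h.proj_kept]

theorem lift_injective (h : Δ.DigonChain d k) : Function.Injective h.lift :=
  Function.LeftInverse.injective h.proj_lift

/-- An oriented edge either survives on its left-hand side or is an edge of a collapsed digon. -/
theorem cases_lift (h : Δ.DigonChain d k) (z : Δ.Edge × Bool) :
    (∃ x, h.lift x = z) ∨ ∃ t < k, z = d t ∨ z = reverseEdge _ (d (t + 1)) := by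
  rcases cases_kept (d := d) (k := k) z with ⟨x, rfl⟩ | ⟨t, h1, hk, rfl | rfl⟩
  · by_cases hx : x = h.base
    · rcases Nat.eq_zero_or_pos k with h0 | h0
      · refine .inl ⟨x, ?_⟩
        rw [hx, h.lift_base]
        exact congrArg d h0
      · refine .inr ⟨0, h0, .inl ?_⟩
        rw [hx]
        rfl
    · exact .inl ⟨x, h.lift_of_ne hx⟩
  · rcases hk.eq_or_lt with rfl | hk
    · exact .inl ⟨h.base, h.lift_base⟩
    · exact .inr ⟨t, hk, .inl rfl⟩
  · refine .inr ⟨t - 1, by omega, .inr ?_⟩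
    rw [Nat.sub_add_cancel h1]

theorem lift_ne_chain (h : Δ.DigonChain d k) (x : KeptEdge Δ d k × Bool) {t : ℕ} (ht : t < k) :
    h.lift x ≠ d t := by
  intro he
  have hx := h.proj_lift x
  rw [he, h.proj_chain ht.le] at hx
  rw [← hx, h.lift_base] at he
  have := h.injective k le_rfl t ht.le (by rw [he])
  omega

theorem lift_ne_reverse_chain (h : Δ.DigonChain d k) (x : KeptEdge Δ d k × Bool) {t : ℕ}
    (ht : t < k) : h.lift x ≠ reverseEdge _ (d (t + 1)) := by
  intro he
  have hx := h.proj_lift x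
  rw [he, h.proj_reverse_chain ht] at hx
  have hne : x ≠ h.base := by
    rw [← hx]
    exact reverseEdge_ne _
  rw [h.lift_of_ne hne] at he
  exact x.1.2 (t + 1) (by omega) ht (congrArg Prod.fst he)

/-- The oriented edges that are lost are exactly the boundaries of the collapsed digons, a set
permuted by `Δ.next`; hence the surviving ones are stable as well. -/
theorem exists_lift_eq_next (h : Δ.DigonChain d k) (x : KeptEdge Δ d k × Bool) :
    ∃ y, h.lift y = Δ.next (h.lift x) := by
  rcases h.cases_lift (Δ.next (h.lift x)) with hy | ⟨t, ht, he | he⟩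
  · exact hy
  · rw [← h.next_backward t ht] at he
    exact absurd (Δ.next.injective he) (h.lift_ne_reverse_chain x ht)
  · rw [← h.next_forward t ht] at he
    exact absurd (Δ.next.injective he) (h.lift_ne_chain x ht)

instance (Δ : PlanarDisk) (d : ℕ → Δ.Edge × Bool) (k : ℕ) : Finite (KeptEdge Δ d k) :=
  have := Δ.finite_edge
  Subtype.finite

/-- The boundary permutation of the collapsed complex. -/
noncomputable def next (h : Δ.DigonChain d k) : Equiv.Perm (KeptEdge Δ d k × Bool) :=
  Equiv.ofBijective (fun x => (h.exists_lift_eq_next x).choose) <|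
    Finite.injective_iff_bijective.1 fun x y hxy => by
      have hx := (h.exists_lift_eq_next x).choose_spec
      have hy := (h.exists_lift_eq_next y).choose_spec
      replace hxy : (h.exists_lift_eq_next x).choose = (h.exists_lift_eq_next y).choose := hxy
      rw [hxy, hy] at hx
      exact h.lift_injective (Δ.next.injective hx.symm)

theorem lift_next (h : Δ.DigonChain d k) (x : KeptEdge Δ d k × Bool) :
    h.lift (h.next x) = Δ.next (h.lift x) :=
  (h.exists_lift_eq_next x).choose_spec

theorem lift_next_iterate (h : Δ.DigonChain d k) (n : ℕ) (x : KeptEdge Δ d k × Bool) :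
    h.lift ((h.next ^ n) x) = (Δ.next ^ n) (h.lift x) := by
  induction n with
  | zero => rfl
  | succ n ih => rw [pow_succ', pow_succ', Equiv.Perm.mul_apply, Equiv.Perm.mul_apply,
      h.lift_next, ih]

theorem sameCycle_lift_iff (h : Δ.DigonChain d k) (x y : KeptEdge Δ d k × Bool) :
    Δ.next.SameCycle (h.lift x) (h.lift y) ↔ h.next.SameCycle x y := by
  have := Δ.finite_edge
  constructor
  · intro hxy
    obtain ⟨n, -, hn⟩ := hxy.exists_pow_eq'
    rw [← h.lift_next_iterate] at hn
    exact ⟨n, by exact_mod_cast h.lift_injective hn⟩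
  · intro hxy
    obtain ⟨n, -, hn⟩ := hxy.exists_pow_eq'
    refine ⟨n, ?_⟩
    rw [← hn, h.lift_next_iterate]
    rfl

theorem exists_lift_of_left_eq (h : Δ.DigonChain d k) {x : KeptEdge Δ d k × Bool}
    {z : Δ.Edge × Bool} (hz : Δ.left (h.lift x) = Δ.left z) : ∃ y, h.lift y = z := by
  have := Δ.finite_edge
  obtain ⟨n, -, hn⟩ := ((Δ.left_eq_iff _ _).1 hz).exists_pow_eq'
  exact ⟨(h.next ^ n) x, by rw [h.lift_next_iterate, hn]⟩

theorem source_chain (h : Δ.DigonChain d k) {t : ℕ} (ht : t ≤ k) :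
    Δ.source (d t) = Δ.source (d 0) := by
  induction t with
  | zero => rfl
  | succ t ih =>
    rw [← ih (by omega), ← h.next_backward t (by omega), source_next, reverseEdge_reverseEdge]

theorem source_reverse_chain (h : Δ.DigonChain d k) {t : ℕ} (ht : t ≤ k) :
    Δ.source (reverseEdge _ (d t)) = Δ.source (reverseEdge _ (d 0)) := by
  induction t with
  | zero => rfl
  | succ t ih => rw [← ih (by omega), ← h.next_forward t (by omega), source_next]

theorem source_lift_proj (h : Δ.DigonChain d k) (z : Δ.Edge × Bool) :
    Δ.source (h.lift (h.proj z)) = Δ.source z := by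
  rcases cases_kept (d := d) (k := k) z with ⟨x, rfl⟩ | ⟨t, -, hk, rfl | rfl⟩
  · rw [h.proj_kept]
    by_cases hx : x = h.base
    · rw [hx, h.lift_base, h.source_chain le_rfl]
      rfl
    · rw [h.lift_of_ne hx]
  · rw [h.proj_chain hk, h.lift_base, h.source_chain le_rfl, h.source_chain hk]
  · rw [h.proj_reverse_chain hk, h.lift_of_ne (reverseEdge_ne _), h.source_reverse_chain hk]
    rfl

theorem source_lift_reverse (h : Δ.DigonChain d k) (x : KeptEdge Δ d k × Bool) :
    Δ.source (h.lift (reverseEdge _ x)) = Δ.source (reverseEdge _ (h.lift x)) := by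
  rw [← h.source_lift_proj (reverseEdge _ (h.lift x)), h.proj_reverse, h.proj_lift]

/-- One rotation step about a vertex becomes one step of the collapsed rotation, or no step at all
when it crosses a collapsed digon. -/
theorem sameCycle_proj (h : Δ.DigonChain d k) (z : Δ.Edge × Bool) :
    (h.next * reverseEdge _).SameCycle (h.proj z)
      (h.proj ((Δ.next * reverseEdge Δ.Edge) z)) := by
  rw [Equiv.Perm.mul_apply]
  obtain ⟨u, rfl⟩ := (reverseEdge Δ.Edge).surjective z
  rw [reverseEdge_reverseEdge, h.proj_reverse]
  rcases h.cases_lift u with ⟨x, rfl⟩ | ⟨t, ht, rfl | rfl⟩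
  · rw [← h.lift_next, h.proj_lift, h.proj_lift]
    refine ⟨1, ?_⟩
    simp
  · rw [h.next_forward t ht, h.proj_reverse, h.proj_chain ht, h.proj_chain ht.le]
  · rw [h.next_backward t ht, h.proj_reverse, h.proj_chain ht, h.proj_chain ht.le,
      reverseEdge_reverseEdge]

theorem source_lift_eq_iff (h : Δ.DigonChain d k) (x y : KeptEdge Δ d k × Bool) :
    Δ.source (h.lift x) = Δ.source (h.lift y) ↔ (h.next * reverseEdge _).SameCycle x y := by
  have := Δ.finite_edge
  constructor
  · intro hxy
    obtain ⟨n, -, hn⟩ := ((Δ.source_eq_iff _ _).1 hxy).exists_pow_eq'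
    have key : ∀ n : ℕ, ∀ z, (h.next * reverseEdge _).SameCycle (h.proj z)
        (h.proj (((Δ.next * reverseEdge Δ.Edge) ^ n) z)) := by
      intro n z
      induction n with
      | zero => exact Equiv.Perm.SameCycle.refl _ _
      | succ n ih =>
        rw [pow_succ', Equiv.Perm.mul_apply]
        exact ih.trans (h.sameCycle_proj _)
    have := key n (h.lift x)
    rwa [hn, h.proj_lift, h.proj_lift] at this
  · intro hxy
    obtain ⟨n, -, rfl⟩ := hxy.exists_pow_eq'
    clear hxy
    induction n with
    | zero => rfl
    | succ n ih =>
      rw [ih, pow_succ', Equiv.Perm.mul_apply, Equiv.Perm.mul_apply, h.lift_next, source_next,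
        ← h.source_lift_reverse, reverseEdge_reverseEdge]

/-- The 2-cells that survive the collapse. -/
abbrev KeptFace (h : Δ.DigonChain d k) : Type :=
  {f : Δ.Face // ∃ x, Δ.left (h.lift x) = some f}

instance (h : Δ.DigonChain d k) : Finite h.KeptFace :=
  have := Δ.finite_face
  Subtype.finite

theorem exists_left (h : Δ.DigonChain d k) (x : KeptEdge Δ d k × Bool) :
    ∃ o : Option h.KeptFace, o.map Subtype.val = Δ.left (h.lift x) := by
  rcases hx : Δ.left (h.lift x) with _ | f
  · exact ⟨none, rfl⟩
  · exact ⟨some ⟨f, x, hx⟩, rfl⟩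

/-- The left-hand regions in the collapsed complex. -/
noncomputable def left (h : Δ.DigonChain d k) (x : KeptEdge Δ d k × Bool) : Option h.KeptFace :=
  (h.exists_left x).choose

theorem map_left (h : Δ.DigonChain d k) (x : KeptEdge Δ d k × Bool) :
    (h.left x).map Subtype.val = Δ.left (h.lift x) :=
  (h.exists_left x).choose_spec

theorem map_val_injective (h : Δ.DigonChain d k) :
    Function.Injective (Option.map Subtype.val : Option h.KeptFace → Option Δ.Face) :=
  Option.map_injective Subtype.val_injective

theorem left_eq_iff_left_lift (h : Δ.DigonChain d k) (x : KeptEdge Δ d k × Bool)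
    (o : Option h.KeptFace) : h.left x = o ↔ Δ.left (h.lift x) = o.map Subtype.val := by
  rw [← h.map_left]
  exact h.map_val_injective.eq_iff.symm

theorem card_keptEdge (h : Δ.DigonChain d k) :
    Nat.card (KeptEdge Δ d k) + k = Nat.card Δ.Edge := by
  classical
  have := Δ.finite_edge
  let S : Set Δ.Edge := (fun t => (d t).1) '' Set.Icc 1 k
  have hS : S.ncard = k := by
    rw [Set.InjOn.ncard_image]
    · rw [← Nat.card_coe_set_eq, Nat.card_eq_fintype_card]
      simp
    · intro i hi j hj hij
      exact h.injective i hi.2 j hj.2 hij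
  have hc : Nat.card (KeptEdge Δ d k) = Sᶜ.ncard := by
    rw [← Nat.card_coe_set_eq]
    refine Nat.card_congr (Equiv.subtypeEquivRight fun e => ?_)
    simp only [S, Set.mem_compl_iff, Set.mem_image, Set.mem_Icc]
    constructor
    · rintro h1 ⟨t, ht, he⟩
      exact h1 t ht.1 ht.2 he.symm
    · intro h1 t ht hk he
      exact h1 ⟨t, ⟨ht, hk⟩, he.symm⟩
  have := Set.ncard_add_ncard_compl S
  omega

theorem left_chain_injective (h : Δ.DigonChain d k) {i j : ℕ} (hi : i < k) (hj : j < k)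
    (hij : Δ.left (d i) = Δ.left (d j)) : i = j := by
  have := Δ.finite_edge
  obtain ⟨n, -, hn⟩ := ((Δ.left_eq_iff _ _).1 hij).exists_pow_eq'
  -- The boundary cycle through `d i` has only these two edges, and the second is reversed relative
  -- to the chain.
  have key : ∀ n : ℕ, (Δ.next ^ n) (d i) = d i ∨
      (Δ.next ^ n) (d i) = reverseEdge _ (d (i + 1)) := by
    intro n
    induction n with
    | zero => exact .inl rfl
    | succ n ih =>
      rw [pow_succ', Equiv.Perm.mul_apply]
      rcases ih with ih | ih
      · exact .inr (by rw [ih, h.next_forward i hi])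
      · exact .inl (by rw [ih, h.next_backward i hi])
  rcases hn ▸ key n with he | he
  · exact (h.injective j hj.le i hi.le (by rw [he])).symm
  · exact absurd he (h.ne_reverseEdge hj.le hi)

theorem card_keptFace (h : Δ.DigonChain d k) :
    Nat.card h.KeptFace + k = Nat.card Δ.Face := by
  classical
  have := Δ.finite_face
  have hex : ∀ t : Fin k, ∃ f, Δ.left (d t) = some f := fun t =>
    Option.ne_none_iff_exists'.1 (h.left_ne t t.2)
  choose g hg using hex
  have hinj : Function.Injective g := fun i j hij =>
    Fin.ext (h.left_chain_injective i.2 j.2 (by rw [hg i, hg j, hij]))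
  have hS : (Set.range g).ncard = k := by
    rw [← Nat.card_coe_set_eq, Nat.card_range_of_injective hinj, Nat.card_fin]
  have hc : Nat.card h.KeptFace = (Set.range g)ᶜ.ncard := by
    rw [← Nat.card_coe_set_eq]
    refine Nat.card_congr (Equiv.subtypeEquivRight fun f => ?_)
    simp only [Set.mem_compl_iff, Set.mem_range]
    constructor
    · rintro ⟨x, hx⟩ ⟨t, rfl⟩
      obtain ⟨y, hy⟩ := h.exists_lift_of_left_eq (hx.trans (hg t).symm)
      exact h.lift_ne_chain y t.2 hy
    · intro hf
      obtain ⟨z, hz⟩ := Δ.face_boundary f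
      rcases h.cases_lift z with ⟨x, rfl⟩ | ⟨t, ht, rfl | rfl⟩
      · exact ⟨x, hz⟩
      · rw [hg ⟨t, ht⟩] at hz
        exact absurd ⟨⟨t, ht⟩, Option.some.inj hz⟩ hf
      · rw [← left_next, h.next_backward t ht, hg ⟨t, ht⟩] at hz
        exact absurd ⟨⟨t, ht⟩, Option.some.inj hz⟩ hf
  have := Set.ncard_add_ncard_compl (Set.range g)
  omega

/-- The complex obtained from `Δ` by collapsing a chain of digons onto its first edge. -/
noncomputable def collapse (h : Δ.DigonChain d k) : PlanarDisk where
  Vertex := Δ.Vertex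
  Edge := KeptEdge Δ d k
  Face := h.KeptFace
  finite_vertex := Δ.finite_vertex
  finite_edge := inferInstance
  finite_face := inferInstance
  nonempty_vertex := Δ.nonempty_vertex
  source x := Δ.source (h.lift x)
  left := h.left
  next := h.next
  left_eq_iff x y := by
    rw [← h.map_val_injective.eq_iff, h.map_left, h.map_left, Δ.left_eq_iff, h.sameCycle_lift_iff]
  source_eq_iff := h.source_lift_eq_iff
  face_boundary := by
    rintro ⟨f, x, hx⟩
    exact ⟨x, (h.left_eq_iff_left_lift _ _).2 hx⟩
  exterior_boundary := by
    rintro ⟨e⟩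
    obtain ⟨z, hz⟩ := Δ.exterior_boundary ⟨e.1⟩
    rcases h.cases_lift z with ⟨x, rfl⟩ | ⟨t, ht, rfl | rfl⟩
    · exact ⟨x, (h.left_eq_iff_left_lift _ _).2 hz⟩
    · exact absurd hz (h.left_ne t ht)
    · rw [← left_next, h.next_backward t ht] at hz
      exact absurd hz (h.left_ne t ht)
  connected u v := by
    refine Relation.ReflTransGen.mono ?_ _ _ (Δ.connected u v)
    rintro p q ⟨z, rfl, rfl⟩
    refine ⟨h.proj z, h.source_lift_proj z, ?_⟩
    rw [← h.proj_reverse, h.source_lift_proj]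
  euler := by
    -- Edges and faces both drop by `k`, so Euler's formula persists.
    have h1 := h.card_keptEdge
    have h2 := h.card_keptFace
    have h3 := Δ.euler
    omega

theorem exists_lift_of_left (h : Δ.DigonChain d k) {z : Δ.Edge × Bool} {o : Option h.KeptFace}
    (hz : Δ.left z = o.map Subtype.val) : ∃ x, h.lift x = z ∧ h.left x = o := by
  have : ∃ x, h.lift x = z := by
    rcases o with _ | ⟨f, y, hy⟩
    · rcases h.cases_lift z with hx | ⟨t, ht, rfl | rfl⟩
      · exact hx
      · exact absurd hz (h.left_ne t ht)
      · rw [← left_next, h.next_backward t ht] at hz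
        exact absurd hz (h.left_ne t ht)
    · exact h.exists_lift_of_left_eq (hy.trans hz.symm)
  obtain ⟨x, rfl⟩ := this
  exact ⟨x, rfl, (h.left_eq_iff_left_lift _ _).2 hz⟩

theorem perimeter_collapse (h : Δ.DigonChain d k) (o : Option h.KeptFace) :
    h.collapse.perimeter o = Δ.perimeter (o.map Subtype.val) := by
  refine Nat.card_congr (Equiv.ofBijective
    (fun x => ⟨h.lift x.1, (h.left_eq_iff_left_lift _ _).1 x.2⟩) ⟨?_, ?_⟩)
  · intro x y hxy
    exact Subtype.ext (h.lift_injective (congrArg Subtype.val hxy))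
  · rintro ⟨z, hz⟩
    obtain ⟨x, hx, ho⟩ := h.exists_lift_of_left hz
    exact ⟨⟨x, ho⟩, Subtype.ext hx⟩

end DigonChain

end PlanarDisk

namespace LabelledDisk

open PlanarDisk

variable {m : ℕ}

/-- The labelling of the collapsed complex. -/
noncomputable def collapse (Δ : LabelledDisk m) {d : ℕ → Δ.Edge × Bool} {k : ℕ}
    (h : Δ.DigonChain d k) : LabelledDisk m where
  toPlanarDisk := h.collapse
  edgeLabel e := Δ.edgeLabel e.1

variable {Δ : LabelledDisk m} {d : ℕ → Δ.Edge × Bool} {k : ℕ}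

theorem letter_lift (h : Δ.DigonChain d k) (hl : Δ.letter (d k) = Δ.letter (d 0))
    (x : DigonChain.KeptEdge Δ.toPlanarDisk d k × Bool) :
    Δ.letter (h.lift x) = (Δ.collapse h).letter x := by
  by_cases hx : x = h.base
  · rw [hx, h.lift_base, hl]
    rfl
  · rw [h.lift_of_ne hx]
    rfl

/-- `lift` intertwines the two boundary permutations, and it preserves letters because `hl` makes
the glued edges carry the same one. -/
theorem reads_collapse (h : Δ.DigonChain d k) (hl : Δ.letter (d k) = Δ.letter (d 0))
    (o : Option h.KeptFace) (W : DehnWord m) (hW : Δ.Reads (o.map Subtype.val) W) :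
    (Δ.collapse h).Reads o W := by
  have hp : (Δ.collapse h).perimeter o = Δ.perimeter (o.map Subtype.val) := h.perimeter_collapse o
  rcases hW with ⟨h0, rfl⟩ | ⟨z, hz, rfl⟩
  · exact .inl ⟨hp.trans h0, rfl⟩
  · obtain ⟨x, rfl, ho⟩ := h.exists_lift_of_left hz
    refine .inr ⟨x, ho, ?_⟩
    rw [hp]
    generalize Δ.perimeter (o.map Subtype.val) = n
    clear ho hz hp
    induction n generalizing x with
    | zero => rfl
    | succ n ih =>
      have hx := ih (h.next x)
      rw [h.lift_next] at hx
      exact congrArg₂ List.cons (letter_lift h hl x) hx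

theorem isVanKampen_collapse (h : Δ.DigonChain d k) (hl : Δ.letter (d k) = Δ.letter (d 0))
    {R : Set (DehnWord m)} (hΔ : Δ.IsVanKampen R) : (Δ.collapse h).IsVanKampen R := by
  intro f
  obtain ⟨r, hr, hf⟩ := hΔ f.1
  exact ⟨r, hr, hf.imp (reads_collapse h hl (some f) _) (reads_collapse h hl (some f) _)⟩

end LabelledDisk

/-! ### Following digons, and the Euler count -/

namespace PlanarDisk

variable (Δ : PlanarDisk)

/-- The oriented edge opposite to `z` in the region to the left of `z`, when this is a digon. -/
def opposite : Equiv.Perm (Δ.Edge × Bool) := reverseEdge Δ.Edge * Δ.next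

/-- The oriented edge `z` has a digonal 2-cell on its left-hand side (or a 2-cell with a boundary
of length 1). -/
def IsDigonal (z : Δ.Edge × Bool) : Prop := Δ.left z ≠ none ∧ Δ.next (Δ.next z) = z

variable {Δ}

theorem reverseEdge_opposite (z : Δ.Edge × Bool) :
    reverseEdge _ (Δ.opposite z) = Δ.next z := by
  simp [opposite]

theorem opposite_pow_succ (n : ℕ) (z : Δ.Edge × Bool) :
    (Δ.opposite ^ (n + 1)) z = Δ.opposite ((Δ.opposite ^ n) z) := by
  rw [pow_succ', Equiv.Perm.mul_apply]

theorem mem_of_source_eq {X : Set (Δ.Edge × Bool)} (hn : ∀ x ∈ X, Δ.next x ∈ X)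
    (hr : ∀ x ∈ X, reverseEdge _ x ∈ X) {a b : Δ.Edge × Bool} (ha : a ∈ X)
    (hab : Δ.source a = Δ.source b) : b ∈ X := by
  have := Δ.finite_edge
  obtain ⟨n, -, rfl⟩ := ((Δ.source_eq_iff _ _).1 hab).exists_pow_eq'
  clear hab
  induction n with
  | zero => exact ha
  | succ n ih =>
    rw [pow_succ', Equiv.Perm.mul_apply]
    exact hn _ (hr _ ih)

/-- A set of oriented edges that is closed under reversal and under passage to the next edge on a
boundary cycle is empty or contains all oriented edges. -/
theorem mem_of_closed {X : Set (Δ.Edge × Bool)} (hn : ∀ x ∈ X, Δ.next x ∈ X)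
    (hr : ∀ x ∈ X, reverseEdge _ x ∈ X) {a : Δ.Edge × Bool} (ha : a ∈ X) (b : Δ.Edge × Bool) :
    b ∈ X := by
  have key : ∀ v, Relation.ReflTransGen (fun p q => ∃ d, Δ.source d = p ∧
      Δ.source (reverseEdge Δ.Edge d) = q) (Δ.source a) v → ∃ x ∈ X, Δ.source x = v := by
    intro v hv
    induction hv with
    | refl => exact ⟨a, ha, rfl⟩
    | tail _ hstep ih =>
      obtain ⟨x, hx, rfl⟩ := ih
      obtain ⟨d, hd, rfl⟩ := hstep
      exact ⟨_, hr d (mem_of_source_eq hn hr hx hd.symm), rfl⟩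
  obtain ⟨x, hx, hxb⟩ := key _ (Δ.connected _ (Δ.source b))
  exact mem_of_source_eq hn hr hx hxb

/-- An endless run of digons would, with its reversals, be closed under `next` and `reverseEdge`. By
connectedness it would reach the exterior, which is not a digon. -/
theorem exists_not_isDigonal (z : Δ.Edge × Bool) :
    ∃ n : ℕ, ¬ Δ.IsDigonal ((Δ.opposite ^ n) z) := by
  by_contra! hz
  have := Δ.finite_edge
  let Y : Set (Δ.Edge × Bool) := {x | ∀ n : ℕ, Δ.IsDigonal ((Δ.opposite ^ n) x)}
  have hY : ∀ x ∈ Y, ∀ n : ℕ, (Δ.opposite ^ n) x ∈ Y := by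
    intro x hx n k
    rw [← Equiv.Perm.mul_apply, ← pow_add]
    exact hx _
  -- Since `opposite` has finite order, `y` is the opposite of some `w` in `Y`; going around that
  -- digon leads back to `w`.
  have hback : ∀ y ∈ Y, Δ.next (reverseEdge _ y) ∈ Y := by
    intro y hy
    have hpos := orderOf_pos Δ.opposite
    have hyy : Δ.opposite ((Δ.opposite ^ (orderOf Δ.opposite - 1)) y) = y := by
      rw [← opposite_pow_succ, Nat.sub_add_cancel hpos, pow_orderOf_eq_one]
      rfl
    have hw := hY y hy (orderOf Δ.opposite - 1)
    generalize (Δ.opposite ^ (orderOf Δ.opposite - 1)) y = w at hyy hw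
    rw [← hyy, reverseEdge_opposite, show Δ.next (Δ.next w) = w from (hw 0).2]
    exact hw
  obtain ⟨w, hw⟩ := Δ.exterior_boundary ⟨z.1⟩
  have hmem : w ∈ {x | x ∈ Y ∨ reverseEdge _ x ∈ Y} := by
    refine mem_of_closed ?_ ?_ (a := z) (.inl hz) w
    · rintro x (hx | hx)
      · refine .inr ?_
        have := hY x hx 1
        rwa [pow_one] at this
      · refine .inl ?_
        have := hback _ hx
        rwa [reverseEdge_reverseEdge] at this
    · rintro x (hx | hx)
      · refine .inr ?_
        rwa [reverseEdge_reverseEdge]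
      · exact .inl hx
  rcases hmem with h | h
  · exact (h 0).1 hw
  · have h' := (hback _ h 0).1
    rw [reverseEdge_reverseEdge, pow_zero, Equiv.Perm.one_apply, left_next] at h'
    exact h' hw

/-- A coincidence at positions `i`, `j` propagates inwards to `i + 1`, `j - 1`. It ends in an edge
equal to its own reverse, or in a 2-cell of perimeter 1. -/
theorem opposite_pow_ne_reverseEdge (hloop : ∀ z, Δ.left z ≠ none → Δ.next z ≠ z)
    {z : Δ.Edge × Bool} {N : ℕ} (hN : ∀ t < N, Δ.IsDigonal ((Δ.opposite ^ t) z))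
    (n : ℕ) : ∀ i j : ℕ, j = i + n → j ≤ N →
      (Δ.opposite ^ i) z ≠ reverseEdge _ ((Δ.opposite ^ j) z) := by
  induction n using Nat.strong_induction_on with
  | _ n ih =>
    intro i j hij hj he
    match n, hij, ih with
    | 0, hij, _ =>
      subst hij
      exact reverseEdge_ne _ he.symm
    | 1, hij, _ =>
      subst hij
      rw [opposite_pow_succ, reverseEdge_opposite] at he
      exact hloop _ (hN i hj).1 he.symm
    | n + 2, hij, ih =>
      subst hij
      refine ih n (by omega) (i + 1) (i + 1 + n) rfl (by omega) ?_
      rw [show i + (n + 2) = i + 1 + n + 1 by ring, opposite_pow_succ,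
        reverseEdge_opposite] at he
      apply (reverseEdge Δ.Edge).injective
      rw [opposite_pow_succ i, reverseEdge_opposite, he, (hN (i + 1 + n) (by omega)).2,
        reverseEdge_reverseEdge]

theorem digonChain_opposite (hloop : ∀ z, Δ.left z ≠ none → Δ.next z ≠ z)
    {z : Δ.Edge × Bool} {N : ℕ} (hN : ∀ t < N, Δ.IsDigonal ((Δ.opposite ^ t) z))
    (hN' : ¬ Δ.IsDigonal ((Δ.opposite ^ N) z)) {k : ℕ} (hk : k ≤ N) :
    Δ.DigonChain (fun t => (Δ.opposite ^ t) z) k where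
  left_ne t ht := (hN t (by omega)).1
  next_forward t ht := by rw [opposite_pow_succ, reverseEdge_opposite]
  next_backward t ht := by
    rw [opposite_pow_succ, reverseEdge_opposite, (hN t (by omega)).2]
  injective := by
    have key : ∀ i j : ℕ, i < j → j ≤ k → ((Δ.opposite ^ i) z).1 ≠ ((Δ.opposite ^ j) z).1 := by
      intro i j hij hj he
      rcases eq_or_eq_reverseEdge he with he | he
      · apply hN'
        have h1 : (Δ.opposite ^ N) z = (Δ.opposite ^ (N - j + i)) z := by
          rw [pow_add, Equiv.Perm.mul_apply, he, ← Equiv.Perm.mul_apply, ← pow_add,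
            Nat.sub_add_cancel (hj.trans hk)]
        rw [h1]
        exact hN _ (by omega)
      · exact opposite_pow_ne_reverseEdge hloop hN (j - i) i j (by omega) (hj.trans hk) he
    intro i hi j hj he
    rcases lt_trichotomy i j with h | h | h
    · exact absurd he (key i j h hj)
    · exact h
    · exact absurd he.symm (key j i h hi)

/-- By Euler's formula, few oriented edges have no digon on their left-hand side. -/
theorem card_not_isDigonal_le (hloop : ∀ z, Δ.left z ≠ none → Δ.next z ≠ z) :
    Nat.card {z // ¬ Δ.IsDigonal z} + 6 ≤ 6 * Nat.card Δ.Vertex := by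
  classical
  have := Δ.finite_edge
  have := Δ.finite_face
  have := Fintype.ofFinite Δ.Edge
  have := Fintype.ofFinite Δ.Face
  -- With these weights every 2-cell receives at least 6: a digon 3 + 3, any longer cell at least 2
  -- + 2 + 2.
  let w : Δ.Edge × Bool → ℕ := fun z => if Δ.IsDigonal z then 3 else 2
  have hw2 : ∀ z, 2 ≤ w z := fun z => by
    simp only [w]
    split_ifs <;> omega
  have hface : ∀ f, 6 ≤ ∑ z with Δ.left z = some f, w z := by
    intro f
    obtain ⟨z, hz⟩ := Δ.face_boundary f
    have hz1 : Δ.left (Δ.next z) = some f := by rw [left_next, hz]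
    have hz2 : Δ.left (Δ.next (Δ.next z)) = some f := by rw [left_next, hz1]
    have hne : Δ.next z ≠ z := hloop z (by simp [hz])
    by_cases hd : Δ.next (Δ.next z) = z
    · have hsub : {z, Δ.next z} ⊆ ({z | Δ.left z = some f} : Finset (Δ.Edge × Bool)) := by
        intro x hx
        simp only [Finset.mem_insert, Finset.mem_singleton] at hx
        rcases hx with rfl | rfl <;> simpa
      refine le_trans ?_ (Finset.sum_le_sum_of_subset hsub)
      rw [Finset.sum_pair hne.symm]
      have h1 : w z = 3 := if_pos ⟨by simp [hz], hd⟩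
      have h2 : w (Δ.next z) = 3 := if_pos ⟨by simp [hz1], by rw [hd]⟩
      omega
    · have hsub : {z, Δ.next z, Δ.next (Δ.next z)} ⊆
          ({z | Δ.left z = some f} : Finset (Δ.Edge × Bool)) := by
        intro x hx
        simp only [Finset.mem_insert, Finset.mem_singleton] at hx
        rcases hx with rfl | rfl | rfl <;> simpa
      refine le_trans ?_ (Finset.sum_le_sum_of_subset hsub)
      have hne' : Δ.next (Δ.next z) ≠ Δ.next z := fun h => hne (Δ.next.injective h)
      rw [Finset.sum_insert (by simp [hne.symm, Ne.symm hd]), Finset.sum_pair hne'.symm]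
      have h1 := hw2 z
      have h2 := hw2 (Δ.next z)
      have h3 := hw2 (Δ.next (Δ.next z))
      omega
  have hfaces : 6 * Nat.card Δ.Face ≤ ∑ z, w z := by
    rw [← Finset.sum_fiberwise Finset.univ Δ.left w, Fintype.sum_option]
    calc 6 * Nat.card Δ.Face = ∑ _f : Δ.Face, 6 := by simp [mul_comm]
      _ ≤ ∑ f, ∑ z with Δ.left z = some f, w z := Finset.sum_le_sum fun f _ => hface f
      _ ≤ _ := Nat.le_add_left _ _
  -- Each non-digonal edge falls short of weight 3 by one, so their number is at most 6E − 6F = 6V −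
  -- 6.
  have hsum : ∑ z, w z + Nat.card {z // ¬ Δ.IsDigonal z} = 6 * Nat.card Δ.Edge := by
    rw [Nat.card_eq_fintype_card, Fintype.card_subtype, Finset.card_filter,
      ← Finset.sum_add_distrib, Finset.sum_congr rfl (g := fun _ => 3)]
    · simp
      ring
    · intro z _
      simp only [w]
      split_ifs <;> rfl
  have := Δ.euler
  omega

end PlanarDisk

/-! ### Linear bound on edges in a reduced diagram -/

namespace LabelledDisk

open PlanarDisk

variable {m : ℕ}

/-- If no chain of digons can be collapsed, then the number of edges is linear in the number of
vertices. -/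
theorem card_edge_le (Δ : LabelledDisk m) (hloop : ∀ z, Δ.left z ≠ none → Δ.next z ≠ z)
    (hred : ∀ (d : ℕ → Δ.Edge × Bool) (k : ℕ), 0 < k → Δ.DigonChain d k →
      Δ.letter (d k) ≠ Δ.letter (d 0)) :
    Nat.card Δ.Edge ≤ 6 * m * Nat.card Δ.Vertex := by
  classical
  have := Δ.finite_edge
  let N : Δ.Edge × Bool → ℕ := fun z => Nat.find (exists_not_isDigonal z)
  have hN : ∀ z, ¬ Δ.IsDigonal ((Δ.opposite ^ N z) z) := fun z =>
    Nat.find_spec (exists_not_isDigonal z)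
  have hlt : ∀ z, ∀ t < N z, Δ.IsDigonal ((Δ.opposite ^ t) z) := fun z t ht =>
    not_not.1 (Nat.find_min (exists_not_isDigonal z) ht)
  -- End of the digon run, with the letter at its start.
  let F : Δ.Edge × Bool → {z // ¬ Δ.IsDigonal z} × (Fin m × Bool) :=
    fun z => (⟨_, hN z⟩, Δ.letter z)
  have key : ∀ z z', N z ≤ N z' → F z = F z' → z = z' := by
    intro z z' hle hF
    have h1 : (Δ.opposite ^ N z) z = (Δ.opposite ^ N z') z' :=
      congrArg Subtype.val (congrArg Prod.fst hF)
    have h2 : Δ.letter z = Δ.letter z' := congrArg Prod.snd hF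
    obtain ⟨k, hk⟩ := Nat.exists_eq_add_of_le hle
    rw [hk, pow_add, Equiv.Perm.mul_apply] at h1
    have h3 := (Δ.opposite ^ N z).injective h1
    rcases Nat.eq_zero_or_pos k with rfl | hpos
    · exact h3
    -- Here `z` lies `k` digons beyond `z'` with the same letter, so the chain between them could be
    -- collapsed.
    · refine absurd ?_ (hred _ k hpos
        (digonChain_opposite hloop (hlt z') (hN z') (k := k) (by omega)))
      rw [← h3, h2]
      rfl
  have hinj : Function.Injective F := fun z z' hF =>
    (le_total (N z) (N z')).elim (fun h => key z z' h hF) fun h => (key z' z h hF.symm).symm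
  have hcard := Nat.card_le_card_of_injective F hinj
  simp only [Nat.card_prod, Nat.card_eq_fintype_card (α := Bool), Fintype.card_bool,
    Nat.card_fin] at hcard
  have h1 : Nat.card {z // ¬ Δ.IsDigonal z} ≤ 6 * Nat.card Δ.Vertex :=
    le_of_add_le_left (card_not_isDigonal_le hloop)
  have h2 := Nat.mul_le_mul_right (m * 2) h1
  have h3 : Nat.card Δ.Edge * 2 ≤ 6 * m * Nat.card Δ.Vertex * 2 := by
    refine (hcard.trans h2).trans (le_of_eq ?_)
    ring
  omega

theorem next_ne_of_one_lt {R : Set (DehnWord m)} (hR : ∀ r ∈ R, 1 < r.length)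
    {Δ : LabelledDisk m} (hΔ : Δ.IsVanKampen R) {z : Δ.Edge × Bool} (hz : Δ.left z ≠ none) :
    Δ.next z ≠ z := by
  intro hfix
  obtain ⟨f, hf⟩ := Option.ne_none_iff_exists'.1 hz
  have hlen : ∀ W : DehnWord m, Δ.Reads (some f) W → W.length = Δ.perimeter (some f) := by
    rintro W (⟨h0, rfl⟩ | ⟨d, -, rfl⟩)
    · exact h0.symm
    · simp
  have h1 : Δ.perimeter (some f) = 1 := by
    refine Nat.card_eq_one_iff_unique.2 ⟨⟨?_⟩, ⟨⟨z, hf⟩⟩⟩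
    have huniq : ∀ d, Δ.left d = some f → d = z := by
      intro d hd
      have := (Δ.left_eq_iff z d).1 (hf.trans hd.symm)
      obtain ⟨n, hn⟩ := this
      rw [← hn]
      exact Equiv.Perm.zpow_apply_eq_self_of_apply_eq_self hfix n
    rintro ⟨a, ha⟩ ⟨b, hb⟩
    exact Subtype.ext ((huniq a ha).trans (huniq b hb).symm)
  obtain ⟨r, hr, h | h⟩ := hΔ f
  · have := hlen r h
    have := hR r hr
    omega
  · have := hlen _ h
    rw [FreeGroup.invRev_length] at this
    have := hR r hr
    omega

end LabelledDisk

/-! ### Comparison of the Dehn functions -/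

section DehnFunction

variable {m : ℕ} {R : Set (DehnWord m)}

theorem dehnL_le {Δ : LabelledDisk m} {W : DehnWord m} (hΔ : Δ.IsVanKampen R)
    (hW : Δ.Reads none W) (j : Fin 3) : dehnL R j W ≤ Δ.numCells j :=
  Nat.sInf_le ⟨Δ, hΔ, hW, rfl⟩

theorem exists_numCells_eq_dehnL {Δ : LabelledDisk m} {W : DehnWord m} (hΔ : Δ.IsVanKampen R)
    (hW : Δ.Reads none W) (j : Fin 3) :
    ∃ Δ' : LabelledDisk m, Δ'.IsVanKampen R ∧ Δ'.Reads none W ∧ Δ'.numCells j = dehnL R j W :=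
  Nat.sInf_mem (s := {n | ∃ Δ : LabelledDisk m, Δ.IsVanKampen R ∧ Δ.Reads none W ∧
    Δ.numCells j = n}) ⟨_, Δ, hΔ, hW, rfl⟩

/-- The infimum of the empty set is 0, so words without a diagram satisfy all the comparisons below
and van Kampen's lemma is not needed. -/
theorem dehnL_eq_zero_of_forall_not (j : Fin 3) {W : DehnWord m}
    (h : ∀ Δ : LabelledDisk m, Δ.IsVanKampen R → ¬ Δ.Reads none W) : dehnL R j W = 0 := by
  refine Nat.sInf_eq_zero.2 (.inr (Set.eq_empty_iff_forall_notMem.2 ?_))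
  rintro n ⟨Δ, hΔ, hW, -⟩
  exact h Δ hΔ hW

theorem PlanarDisk.card_vertex_pos (Δ : PlanarDisk) : 0 < Nat.card Δ.Vertex :=
  have := Δ.finite_vertex
  have := Δ.nonempty_vertex
  Nat.card_pos

theorem dehnL_zero_le (W : DehnWord m) :
    dehnL R 0 W ≤ 2 * dehnL R 1 W ∨ dehnL R 0 W ≤ 1 := by
  by_cases h : ∃ Δ : LabelledDisk m, Δ.IsVanKampen R ∧ Δ.Reads none W
  · obtain ⟨Δ, hΔ, hW⟩ := h
    obtain ⟨Δ', hΔ', hW', h1⟩ := exists_numCells_eq_dehnL hΔ hW 1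
    have h0 : dehnL R 0 W ≤ Nat.card Δ'.Vertex := dehnL_le hΔ' hW' 0
    replace h1 : Nat.card Δ'.Edge = dehnL R 1 W := h1
    have := Δ'.euler
    omega
  · push Not at h
    rw [dehnL_eq_zero_of_forall_not 0 h]
    omega

theorem dehnL_two_le (W : DehnWord m) : dehnL R 2 W ≤ 2 * dehnL R 1 W := by
  by_cases h : ∃ Δ : LabelledDisk m, Δ.IsVanKampen R ∧ Δ.Reads none W
  · obtain ⟨Δ, hΔ, hW⟩ := h
    obtain ⟨Δ', hΔ', hW', h1⟩ := exists_numCells_eq_dehnL hΔ hW 1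
    have h2 : dehnL R 2 W ≤ Nat.card Δ'.Face := dehnL_le hΔ' hW' 2
    replace h1 : Nat.card Δ'.Edge = dehnL R 1 W := h1
    have := Δ'.euler
    have := Δ'.card_vertex_pos
    omega
  · push Not at h
    rw [dehnL_eq_zero_of_forall_not 2 h]
    omega

theorem dehnL_one_le (hR : ∀ r ∈ R, 1 < r.length) (W : DehnWord m) :
    dehnL R 1 W ≤ 6 * m * dehnL R 0 W := by
  classical
  by_cases h : ∃ Δ : LabelledDisk m, Δ.IsVanKampen R ∧ Δ.Reads none W
  · obtain ⟨Δ₀, hΔ₀, hW₀⟩ := h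
    -- Fewest vertices first, then fewest edges: a collapse keeps the former and lowers the latter.
    have hex : ∃ n, ∃ Δ : LabelledDisk m, Δ.IsVanKampen R ∧ Δ.Reads none W ∧
        Nat.card Δ.Vertex = dehnL R 0 W ∧ Nat.card Δ.Edge = n := by
      obtain ⟨Δ, hΔ, hW, h0⟩ := exists_numCells_eq_dehnL hΔ₀ hW₀ 0
      exact ⟨_, Δ, hΔ, hW, h0, rfl⟩
    obtain ⟨Δ, hΔ, hW, hV, hE⟩ := Nat.find_spec hex
    have h1 : dehnL R 1 W ≤ Nat.card Δ.Edge := dehnL_le hΔ hW 1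
    rw [← hV]
    refine h1.trans (Δ.card_edge_le (fun z hz => LabelledDisk.next_ne_of_one_lt hR hΔ hz) ?_)
    intro d k hk hd hl
    have hlt : Nat.card (PlanarDisk.DigonChain.KeptEdge Δ.toPlanarDisk d k) < Nat.find hex := by
      have := hd.card_keptEdge
      omega
    exact Nat.find_min hex hlt ⟨Δ.collapse hd, LabelledDisk.isVanKampen_collapse hd hl hΔ,
      LabelledDisk.reads_collapse hd hl none W hW, hV, rfl⟩
  · push Not at h
    rw [dehnL_eq_zero_of_forall_not 1 h]
    exact Nat.zero_le _

/-- Only finitely many words have length at most `x`, so the supremum is a true maximum and not the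
default value 0. -/
theorem bddAbove_dehnL (R : Set (DehnWord m)) (j : Fin 3) (x : ℕ) :
    BddAbove {n | ∃ W : DehnWord m, InNormalClosure R W ∧ W.length ≤ x ∧ dehnL R j W = n} := by
  refine (((List.finite_length_le (Fin m × Bool) x).image (dehnL R j)).subset ?_).bddAbove
  rintro n ⟨W, -, hW, rfl⟩
  exact ⟨W, hW, rfl⟩

theorem dehnL_le_dehnFunction {W : DehnWord m} (hW : InNormalClosure R W) {x : ℕ}
    (hx : W.length ≤ x) (j : Fin 3) : dehnL R j W ≤ dehnFunction R j x :=
  le_csSup (bddAbove_dehnL R j x) ⟨W, hW, hx, rfl⟩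

theorem dehnFunction_le {j : Fin 3} {x n : ℕ}
    (h : ∀ W : DehnWord m, InNormalClosure R W → W.length ≤ x → dehnL R j W ≤ n) :
    dehnFunction R j x ≤ n := by
  refine csSup_le ⟨_, [], ?_, Nat.zero_le x, rfl⟩ ?_
  · exact one_mem (Subgroup.normalClosure (FreeGroup.mk '' R))
  · rintro k ⟨W, hW, hx, rfl⟩
    exact h W hW hx

theorem dehnFunction_mono (R : Set (DehnWord m)) (j : Fin 3) : Monotone (dehnFunction R j) :=
  fun _ _ hxy => dehnFunction_le fun _ hW hx => dehnL_le_dehnFunction hW (hx.trans hxy) j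

theorem dehnFunction_zero_le (R : Set (DehnWord m)) (x : ℕ) :
    dehnFunction R 0 x ≤ max (2 * dehnFunction R 1 x) 1 := by
  refine dehnFunction_le fun W hW hx => ?_
  have := dehnL_le_dehnFunction hW hx 1
  rcases dehnL_zero_le (R := R) W with h | h
  · exact le_max_of_le_left (by omega)
  · exact le_max_of_le_right h

theorem dehnFunction_two_le (R : Set (DehnWord m)) (x : ℕ) :
    dehnFunction R 2 x ≤ 2 * dehnFunction R 1 x :=
  dehnFunction_le fun W hW hx =>
    (dehnL_two_le W).trans (Nat.mul_le_mul_left _ (dehnL_le_dehnFunction hW hx 1))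

theorem dehnFunction_one_le (hR : ∀ r ∈ R, 1 < r.length) (x : ℕ) :
    dehnFunction R 1 x ≤ 6 * m * dehnFunction R 0 x :=
  dehnFunction_le fun W hW hx =>
    (dehnL_one_le hR W).trans (Nat.mul_le_mul_left _ (dehnL_le_dehnFunction hW hx 0))

/-- The diagram that consists of one edge and its two endpoints. -/
def segmentDisk (a : Fin m) : LabelledDisk m where
  Vertex := Bool
  Edge := Unit
  Face := Empty
  finite_vertex := inferInstance
  finite_edge := inferInstance
  finite_face := inferInstance
  nonempty_vertex := inferInstance
  source d := d.2
  left _ := none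
  next := reverseEdge Unit
  left_eq_iff d d' := by
    refine ⟨fun _ => ?_, fun _ => rfl⟩
    rcases PlanarDisk.eq_or_eq_reverseEdge (d := d) (d' := d') rfl with rfl | rfl
    · exact Equiv.Perm.SameCycle.refl _ _
    · exact Equiv.Perm.sameCycle_apply_left.2 (Equiv.Perm.SameCycle.refl _ _)
  source_eq_iff d d' := by
    have : reverseEdge Unit * reverseEdge Unit = 1 := by
      ext d
      simp
    rw [this, Equiv.Perm.sameCycle_one]
    exact ⟨fun h => Prod.ext rfl h, fun h => congrArg Prod.snd h⟩
  face_boundary := nofun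
  exterior_boundary _ := ⟨((), true), rfl⟩
  connected u v := by
    by_cases h : u = v
    · rw [h]
    · refine .single ⟨((), u), rfl, ?_⟩
      cases u <;> cases v <;> simp_all [PlanarDisk.reverseEdge_apply]
  euler := by simp
  edgeLabel _ := a

theorem segmentDisk_reads (a : Fin m) : (segmentDisk a).Reads none [(a, true), (a, false)] := by
  have hp : (segmentDisk a).perimeter none = 2 := by
    change Nat.card {d : Unit × Bool // (none : Option Empty) = none} = 2
    simp
  refine .inr ⟨((), true), rfl, ?_⟩
  rw [hp]
  rfl

/-- The word a a⁻¹ has length 2 and represents 1, and a nonempty boundary label forces an edge. -/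
theorem one_le_dehnFunction_one (R : Set (DehnWord m)) (hm : 0 < m) {x : ℕ} (hx : 2 ≤ x) :
    1 ≤ dehnFunction R 1 x := by
  have hcl : InNormalClosure R [(⟨0, hm⟩, true), (⟨0, hm⟩, false)] := by
    have : FreeGroup.mk [((⟨0, hm⟩ : Fin m), true), (⟨0, hm⟩, false)] = 1 :=
      FreeGroup.Red.exact.2
        ⟨[], (FreeGroup.Red.Step.cons_not (b := true)).to_red, .refl⟩
    rw [InNormalClosure, this]
    exact one_mem _
  refine le_trans ?_ (dehnL_le_dehnFunction hcl hx 1)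
  -- The segment shows that a diagram exists, so the infimum is attained rather than 0 by default.
  obtain ⟨Δ, -, hW, h1⟩ := exists_numCells_eq_dehnL (R := R) (Δ := segmentDisk ⟨0, hm⟩) nofun
    (segmentDisk_reads _) 1
  rw [← h1]
  change 1 ≤ Nat.card Δ.Edge
  have := Δ.finite_edge
  rcases hW with ⟨-, h⟩ | ⟨d, -, -⟩
  · simp at h
  · have : Nonempty Δ.Edge := ⟨d.1⟩
    exact Nat.card_pos

theorem linearlyDominated_of_le {f g : ℕ → ℕ} (hg : Monotone g) {C : ℕ} (hC : 0 < C)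
    (h : ∀ x, 1 ≤ x → f x ≤ C * g x + C * x) : LinearlyDominated f g :=
  ⟨C, hC, fun x hx => (h x hx).trans <| Nat.add_le_add_right
    (Nat.mul_le_mul_left _ (hg (Nat.le_mul_of_pos_left x hC))) _⟩

end DehnFunction

theorem theorem1p4 {m : ℕ} (R : Set (DehnWord m))
    (hR : ∀ r ∈ R, r ≠ [] ∧ FreeGroup.IsCyclicallyReduced r) :
    -- part (a)
    ((∀ x : ℕ, 1 ≤ x →
        dehnFunction R 0 x ≤ 2 * dehnFunction R 1 x ∨
          (dehnFunction R 1 x = 0 ∧ dehnFunction R 0 x = 1)) ∧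
      (0 < m → ∀ x : ℕ, 2 ≤ x → dehnFunction R 0 x ≤ 2 * dehnFunction R 1 x) ∧
      (∀ x : ℕ, 1 ≤ x → dehnFunction R 2 x ≤ 2 * dehnFunction R 1 x) ∧
      LinearlyDominated (dehnFunction R 0) (dehnFunction R 1) ∧
      LinearlyDominated (dehnFunction R 2) (dehnFunction R 1)) ∧
    -- part (b)
    ((∀ r ∈ R, 1 < r.length) →
      LinearlyEquivalent (dehnFunction R 0) (dehnFunction R 1) ∧
      ∀ x : ℕ, 1 ≤ x → dehnFunction R 1 x ≤ 3 * (1 + 2 * m) * dehnFunction R 0 x) := by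
  have hdom : LinearlyDominated (dehnFunction R 0) (dehnFunction R 1) := by
    refine linearlyDominated_of_le (dehnFunction_mono R 1) two_pos fun x hx => ?_
    have := dehnFunction_zero_le R x
    omega
  refine ⟨⟨fun x _ => ?_, fun hm x hx => ?_, fun x _ => dehnFunction_two_le R x, hdom, ?_⟩,
    fun hR' => ?_⟩
  · have := dehnFunction_zero_le R x
    omega
  · have := dehnFunction_zero_le R x
    have := one_le_dehnFunction_one R hm hx
    omega
  · exact linearlyDominated_of_le (dehnFunction_mono R 1) two_pos fun x _ =>
      (dehnFunction_two_le R x).trans (Nat.le_add_right _ _)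
  · have hle : ∀ x, dehnFunction R 1 x ≤ 3 * (1 + 2 * m) * dehnFunction R 0 x := fun x =>
      -- The count gives the sharper constant 6m ≤ 3(1 + 2m).
      (dehnFunction_one_le hR' x).trans (Nat.mul_le_mul_right _ (by omega))
    refine ⟨⟨hdom, ?_⟩, fun x _ => hle x⟩
    exact linearlyDominated_of_le (dehnFunction_mono R 0) (by omega) fun x _ =>
      (hle x).trans (Nat.le_add_right _ _)
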